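/- Consider a sequence of temporal stochastic block models with $N\to\infty$ nodes, $K$ blocks $C_1,\dots,C_K$ of sizes $N_1,\dots,N_K$ and $T$ snapshots; $K$, $T$, the block structure $\sigma:[N]\to[K]$ and the symmetric family $f_{k\ell}=f_{\ell k}$ of probability distributions on $\{0,1\}^T$ may all depend on $N$. Given $\sigma$, the interaction patterns $X_{ij}\in\{0,1\}^T$ of distinct node pairs $i<j$ are independent, and $X_{ij}$ has distribution $f_{\sigma(i)\sigma(j)}$. Let $p_{k\ell}^T=f_{k\ell}(1,\dots,1)$ be the probability of a persistent interaction of duration $T$ between two nodes in blocks $k$ and $\ell$. Let $G^t$ be the graph on $[N]$ with edges $\{ij: X_{ij}^t=1\}$ and let $G_T=\bigcap_{t=1}^T G^t$. The algorithm computes the connected components of $G_T$. The components with at least $m$ nodes are the estimated blocks and receive distinct labels, $\hat K$ is their number, and nodes in smaller components (if there are any) are labelled arbitrarily; $m=m_N$ is a size cutoff, where $m=0$ means that all components are returned, and a standard choice is $m=N^{1/2}$. Let $\hat\sigma$ be the output. The classification error $\mathrm{Ham}^*(\hat\sigma,\sigma)$ is the Hamming distance minimised over all permutations of the labels. Assume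 that $\max_{k\ne\ell} p_{k\ell}^T \ll N^{-2}$. All limits below are as $N\to\infty$. (i) (Exact recovery.) Suppose that $m\le\min_k N_k$ for all large $N$. If $$\min_{k} \frac{N_k\, p_{kk}^T}{\log (K N_k)} \ge 1+\Omega(1) \quad\text{and}\quad \min_k K N_k\to\infty,$$ or, more generally, if $\min_k\big(N_k\,p_{kk}^T-\log(KN_k)\big)\to\infty$, then $\mathbb P\big(\mathrm{Ham}^*(\hat\sigma,\sigma)=0 \text{ and } \hat K=K\big)\to1$. (ii) (Consistency.) If $K m = o(N)$ (which always holds for $m=0$, and holds for $m=N^{1/2}$ when $K=O(1)$) and $\min_k N_k\, p_{kk}^T\to\infty$, then $\mathbb E\,\mathrm{Ham}^*(\hat\sigma,\sigma)=o(N)$. (iii) (Number of blocks.) If $\min_k N_k\,p_{kk}^T\to\infty$ and there is a constant $\delta>0$ such that $N^{1/2}\le m\le(1-\delta)\min_k N_k$ for all large $N$, then $\mathbb P(\hat K=K)\to1$. -/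

import Mathlib

open Filter Topology MeasureTheory

/-- A (not necessarily homogeneous) temporal stochastic block model with `N` nodes, `K` blocks,
`T` snapshots, true node labelling `σ`, and interaction distributions `f k l` on `{0,1}^T`. -/
structure TemporalSBM where
  N : ℕ
  K : ℕ
  T : ℕ
  σ : Fin N → Fin K
  f : Fin K → Fin K → PMF (Fin T → Bool)
  f_symm : ∀ k l, f k l = f l k

namespace TemporalSBM

/-- The number `N_k` of nodes in block `k`. -/
def blockSize (M : TemporalSBM) (k : Fin M.K) : ℕ :=
  (Finset.univ.filter fun i => M.σ i = k).card

/-- The probability `p_{kl}^T = f_{kl}(1,…,1)` of a persistent interaction of duration `T`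
between a node in block `k` and a node in block `l`. -/
noncomputable def persistProb (M : TemporalSBM) (k l : Fin M.K) : ℝ :=
  (M.f k l fun _ => true).toReal

/-- Observations: one interaction pattern in `{0,1}^T` for each node pair `i < j`. -/
abbrev Obs (M : TemporalSBM) : Type :=
  {p : Fin M.N × Fin M.N // p.1 < p.2} → Fin M.T → Bool

/-- The law of the observations: the patterns of distinct node pairs are independent, and
the pattern of the pair `i, j` has distribution `f_{σ(i) σ(j)}`. -/
noncomputable def law (M : TemporalSBM) : Measure M.Obs :=
  Measure.pi fun p => (M.f (M.σ p.1.1) (M.σ p.1.2)).toMeasure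

/-- The snapshot graph `G^t`: the node pairs that interact at time `t`. -/
def snapshot (M : TemporalSBM) (x : M.Obs) (t : Fin M.T) : SimpleGraph (Fin M.N) :=
  SimpleGraph.fromRel fun i j => ∃ h : i < j, x ⟨(i, j), h⟩ t = true

/-- The intersection of all snapshot graphs. -/
def persistentGraph (M : TemporalSBM) (x : M.Obs) : SimpleGraph (Fin M.N) :=
  ⨅ t, M.snapshot x t

/-- The true labelling with labels read as natural numbers. -/
def trueLabel (M : TemporalSBM) (i : Fin M.N) : ℕ := (M.σ i : ℕ)

end TemporalSBM

/-- The connected component of node `i` in `G` has at least `m` nodes. -/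
def InLargeComponent {n : ℕ} (G : SimpleGraph (Fin n)) (m : ℝ) (i : Fin n) : Prop :=
  m ≤ ((G.connectedComponentMk i).supp.ncard : ℝ)

/-- `τ` is an output of clustering by connected components of `G` with size cutoff `m`: the
components with at least `m` nodes are the estimated blocks, and receive distinct labels; nodes
in smaller components, if there are any, are labelled arbitrarily. With `m = 0` the estimated
blocks are all connected components of `G`. -/
def IsComponentLabelling {n : ℕ} (G : SimpleGraph (Fin n)) (m : ℝ) (τ : Fin n → ℕ) : Prop :=
  ∀ i j, InLargeComponent G m i → InLargeComponent G m j → (τ i = τ j ↔ G.Reachable i j)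

/-- The estimated number of blocks: the number of components with at least `m` nodes. -/
noncomputable def estimatedBlockCount {n : ℕ} (G : SimpleGraph (Fin n)) (m : ℝ) : ℕ :=
  {c : G.ConnectedComponent | m ≤ (c.supp.ncard : ℝ)}.ncard

/-- Absolute classification error: the Hamming distance of two node labellings, minimised over
all permutations of the labels. The label set is `ℕ`, because the two labellings need not use
the same number of labels; for labellings with values in `{0, …, K - 1}` the minimum over the
permutations of that set is the same. -/
noncomputable def classificationError {n : ℕ} (σ τ : Fin n → ℕ) : ℕ :=
  ⨅ ρ : Equiv.Perm ℕ, hammingDist σ (ρ ∘ τ)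

/-- Outputs exist for every graph and every cutoff. -/
theorem exists_isComponentLabelling {n : ℕ} (G : SimpleGraph (Fin n)) (m : ℝ) :
    ∃ τ, IsComponentLabelling G m τ := by
  classical
  obtain ⟨e⟩ : Nonempty (G.ConnectedComponent ↪ ℕ) := by
    have := Fintype.ofFinite G.ConnectedComponent
    exact ⟨(Fintype.equivFin _).toEmbedding.trans Fin.valEmbedding⟩
  exact ⟨fun i => e (G.connectedComponentMk i), fun i j _ _ => by
    rw [e.injective.eq_iff, SimpleGraph.ConnectedComponent.eq]⟩

/-!
The law of the persistent graph `G_T` is an inhomogeneous random graph: a pair of nodes in blocks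
`k` and `l` is an edge with probability `p_kl`, independently of the other pairs
(`TemporalSBM.law_cylinder`). Since `N² max_{k ≠ l} p_kl → 0`, a union bound shows that with high
probability no edge joins two blocks (`TemporalSBM.law_not_noInterBlockEdge_le`). On that event each
component lies in one block, and everything depends on the components inside a single block, an
Erdős–Rényi graph with `n = N_k` nodes, edge probability `p = p_kk` and mean degree `c = n p`.

All three claims rest on one first moment estimate. A set of `s ≤ n / 2` nodes is a component of its
block only if it contains `s - 1` edges (those of a spanning tree) and has none of its `s (n - s)`
edges to the rest of the block. Summing over the sets and over the possible `s - 1` edges, the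
expected number of nodes in components of size `s` is at most
`n exp (2 s) c ^ (s - 1) exp (-p s (n - s))` (`TemporalSBM.law_isCluster_le`, `clusterMass_le`).
With `r = exp 2 * c * exp (-c / 4)`, which tends to `0` as `c → ∞`, this is at most `n r ^ s`
(`clusterMass_le_pow`), and also at most `exp 3 * n * exp (-c) * r ^ (s - 1)`
(`clusterMass_le_exp_mul_pow`).

* Exact recovery. The second bound makes the expected size of all minority components of block `k`
  of order `N_k exp (-N_k p_kk)`. If `N_k p_kk ≥ log (K N_k) + ω` this is at most `exp (-ω) / K`,
  so the sum over the blocks vanishes: every component is a majority of its block, hence is the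
  block.
* Consistency. The first bound gives `o(N)` nodes in minority components, and blocks with fewer than
  `2 m` nodes contain at most `2 K m = o(N)` nodes. Every other node lies in a majority component
  with at least `m` nodes of its block, and these components are labelled correctly.
* Number of blocks. The first bound, summed over `s ≥ √N`, shows that all components with at least
  `√N` nodes are majorities, so each block contains at most one component with `m` nodes. That there
  is one follows from a union bound over the cuts of a block into two parts of proportion at least
  `δ`: with high probability each of them is crossed by an edge
  (`TemporalSBM.law_exists_balanced_cut_le`), which forces a component of proportion at least
  `1 - δ` (`NoInterBlockEdge.exists_giant`).
-/

/-! ### Relabelling -/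

/-- If `τ` and `σ` induce the same partition on `W`, the labels of `τ` can be renamed so that
`σ` and `τ` agree on `W`. -/
theorem classificationError_le_card_compl {n : ℕ} {σ τ : Fin n → ℕ} (W : Finset (Fin n))
    (h : ∀ i ∈ W, ∀ j ∈ W, τ i = τ j ↔ σ i = σ j) :
    classificationError σ τ ≤ Wᶜ.card := by
  classical
  let p : ℕ → Prop := fun a => a ∈ W.image τ
  let q : ℕ → Prop := fun a => a ∈ W.image σ
  have hτ : ∀ a : {a // p a}, ∃ i ∈ W, τ i = a := fun a => Finset.mem_image.1 a.2
  choose u huW hu using hτ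
  let e : {a // p a} → {a // q a} := fun a => ⟨σ (u a), Finset.mem_image_of_mem _ (huW a)⟩
  have he : Function.Bijective e := by
    constructor
    · intro a b hab
      have hσ : σ (u a) = σ (u b) := congrArg Subtype.val hab
      have := (h _ (huW a) _ (huW b)).2 hσ
      rw [hu, hu] at this
      exact Subtype.ext this
    · rintro ⟨b, hb⟩
      obtain ⟨i, hi, rfl⟩ := Finset.mem_image.1 hb
      refine ⟨⟨τ i, Finset.mem_image_of_mem _ hi⟩, Subtype.ext ?_⟩
      exact (h _ (huW _) _ hi).1 (hu _)
  have : Finite ({a | p a} : Set ℕ) := (W.image τ).finite_toSet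
  let ρ : Equiv.Perm ℕ := (Equiv.ofBijective e he).extendSubtype
  have hρ : ∀ i ∈ W, ρ (τ i) = σ i := by
    intro i hi
    have hi' : p (τ i) := Finset.mem_image_of_mem _ hi
    have h1 : ρ (τ i) = e ⟨τ i, hi'⟩ :=
      Equiv.extendSubtype_apply_of_mem (Equiv.ofBijective e he) _ hi'
    rw [h1]
    exact (h _ (huW _) _ hi).1 (hu _)
  refine (ciInf_le (OrderBot.bddBelow _) ρ).trans (Finset.card_le_card fun i hi => ?_)
  rw [Finset.mem_compl]
  intro hiW
  exact (Finset.mem_filter.1 hi).2 (hρ i hiW).symm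

theorem classificationError_le_card {n : ℕ} (σ τ : Fin n → ℕ) : classificationError σ τ ≤ n := by
  simpa using classificationError_le_card_compl (σ := σ) (τ := τ) ∅ (by simp)

/-! ### Components inside blocks -/

section Blocks

variable {n K : ℕ} {G : SimpleGraph (Fin n)} {σ : Fin n → Fin K}

/-- The set of nodes that `σ` assigns to block `k`. -/
def block (σ : Fin n → Fin K) (k : Fin K) : Finset (Fin n) :=
  Finset.univ.filter fun i => σ i = k

@[simp] theorem mem_block {k : Fin K} {i : Fin n} : i ∈ block σ k ↔ σ i = k := by simp [block]

/-- The set of nodes in the connected component of `i`. -/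
noncomputable def nodeComponent (G : SimpleGraph (Fin n)) (i : Fin n) : Finset (Fin n) := by
  classical exact Finset.univ.filter (G.Reachable i)

@[simp] theorem mem_nodeComponent {i j : Fin n} : j ∈ nodeComponent G i ↔ G.Reachable i j := by
  simp [nodeComponent]

theorem coe_nodeComponent (G : SimpleGraph (Fin n)) (i : Fin n) :
    (nodeComponent G i : Set (Fin n)) = (G.connectedComponentMk i).supp := by
  ext j
  simp [SimpleGraph.reachable_comm]

theorem inLargeComponent_iff {m : ℝ} {i : Fin n} :
    InLargeComponent G m i ↔ m ≤ ((nodeComponent G i).card : ℝ) := by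
  rw [InLargeComponent, ← coe_nodeComponent, Set.ncard_coe_finset]

/-- No edge joins two different blocks. -/
def NoInterBlockEdge (G : SimpleGraph (Fin n)) (σ : Fin n → Fin K) : Prop :=
  ∀ i j, G.Adj i j → σ i = σ j

/-- The nodes of `U` have no neighbours in the rest of `B`. -/
def IsSeparated (G : SimpleGraph (Fin n)) (B U : Finset (Fin n)) : Prop :=
  ∀ i ∈ U, ∀ j ∈ B \ U, ¬ G.Adj i j

/-- `S` spans a connected graph, and has no neighbours in the rest of `B`; for `S ⊆ B` this says
that `S` is a connected component of the graph induced on `B`. -/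
def IsCluster (G : SimpleGraph (Fin n)) (B S : Finset (Fin n)) : Prop :=
  (G.induce (S : Set (Fin n))).Connected ∧ IsSeparated G B S

theorem NoInterBlockEdge.eq_of_reachable (h : NoInterBlockEdge G σ) {i j : Fin n}
    (hij : G.Reachable i j) : σ i = σ j := by
  obtain ⟨w⟩ := hij
  induction w with
  | nil => rfl
  | cons hadj _ ih => exact (h _ _ hadj).trans ih

theorem NoInterBlockEdge.nodeComponent_subset (h : NoInterBlockEdge G σ) (i : Fin n) :
    nodeComponent G i ⊆ block σ (σ i) := fun j hj => by
  simpa using (h.eq_of_reachable (mem_nodeComponent.1 hj)).symm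

theorem isSeparated_nodeComponent (B : Finset (Fin n)) (i : Fin n) :
    IsSeparated G B (nodeComponent G i) := by
  intro a ha b hb hab
  rw [Finset.mem_sdiff] at hb
  exact hb.2 (mem_nodeComponent.2 ((mem_nodeComponent.1 ha).trans hab.reachable))

theorem isCluster_nodeComponent (B : Finset (Fin n)) (i : Fin n) :
    IsCluster G B (nodeComponent G i) := by
  refine ⟨?_, isSeparated_nodeComponent B i⟩
  rw [coe_nodeComponent]
  exact (G.connectedComponentMk i).connected_toSimpleGraph

/-- Two components that each hold more than half of the same block meet. -/
theorem NoInterBlockEdge.reachable_of_majority (h : NoInterBlockEdge G σ) {i j : Fin n}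
    (hij : σ i = σ j) (hi : (block σ (σ i)).card < 2 * (nodeComponent G i).card)
    (hj : (block σ (σ j)).card < 2 * (nodeComponent G j).card) : G.Reachable i j := by
  have hsub := h.nodeComponent_subset j
  rw [← hij] at hj hsub
  obtain ⟨a, ha⟩ := Finset.inter_nonempty_of_card_lt_card_add_card
    (h.nodeComponent_subset i) hsub (by omega)
  rw [Finset.mem_inter, mem_nodeComponent, mem_nodeComponent] at ha
  exact ha.1.trans ha.2.symm

/-- If every block contains a large component and large components in the same block coincide,
the large components correspond to the blocks. -/
theorem NoInterBlockEdge.estimatedBlockCount_eq {m : ℝ}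
    (h : NoInterBlockEdge G σ) (hex : ∀ k, ∃ i, σ i = k ∧ InLargeComponent G m i)
    (huniq : ∀ i j, InLargeComponent G m i → InLargeComponent G m j → σ i = σ j →
      G.Reachable i j) :
    estimatedBlockCount G m = K := by
  choose u hu hlarge using hex
  let e : Fin K → {c : G.ConnectedComponent | m ≤ (c.supp.ncard : ℝ)} :=
    fun k => ⟨G.connectedComponentMk (u k), hlarge k⟩
  have he : Function.Bijective e := by
    constructor
    · intro k l hkl
      have := SimpleGraph.ConnectedComponent.exact (congrArg Subtype.val hkl)
      rw [← hu k, ← hu l]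
      exact h.eq_of_reachable this
    · rintro ⟨c, hc⟩
      induction c using SimpleGraph.ConnectedComponent.ind with
      | h v =>
        exact ⟨σ v, Subtype.ext (SimpleGraph.ConnectedComponent.sound
          (huniq _ _ (hlarge _) hc (hu _)))⟩
  rw [estimatedBlockCount, ← Nat.card_coe_set_eq, ← Nat.card_congr (Equiv.ofBijective e he),
    Nat.card_fin]

/-- If every cluster of every block is a majority, the components are exactly the blocks. -/
theorem NoInterBlockEdge.exact_recovery {m : ℝ} {τ : Fin n → ℕ}
    (h : NoInterBlockEdge G σ) (hτ : IsComponentLabelling G m τ)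
    (hne : ∀ k, (block σ k).Nonempty) (hm : ∀ k, m ≤ ((block σ k).card : ℝ))
    (hmaj : ∀ k, ∀ S ⊆ block σ k, IsCluster G (block σ k) S → (block σ k).card < 2 * S.card) :
    classificationError (fun i => (σ i : ℕ)) τ = 0 ∧ estimatedBlockCount G m = K := by
  have hmaj' : ∀ i, (block σ (σ i)).card < 2 * (nodeComponent G i).card := fun i =>
    hmaj _ _ (h.nodeComponent_subset i) (isCluster_nodeComponent _ i)
  have hreach : ∀ i j, σ i = σ j → G.Reachable i j := fun i j hij =>
    h.reachable_of_majority hij (hmaj' i) (hmaj' j)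
  have hlarge : ∀ i, InLargeComponent G m i := fun i => by
    have : nodeComponent G i = block σ (σ i) :=
      (h.nodeComponent_subset i).antisymm fun j hj =>
        mem_nodeComponent.2 (hreach _ _ (mem_block.1 hj).symm)
    rw [inLargeComponent_iff, this]
    exact hm _
  constructor
  · have := classificationError_le_card_compl (σ := fun i => (σ i : ℕ)) (τ := τ) Finset.univ
      fun i _ j _ => by
        rw [hτ i j (hlarge i) (hlarge j), Fin.val_inj]
        exact ⟨h.eq_of_reachable, hreach i j⟩
    simpa using this
  · refine h.estimatedBlockCount_eq (fun k => ?_) fun i j _ _ => hreach i j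
    obtain ⟨i, hi⟩ := hne k
    exact ⟨i, mem_block.1 hi, hlarge i⟩

/-- Only nodes of blocks with fewer than `2 m` nodes and nodes in minority clusters of their
block can be misclassified. -/
theorem NoInterBlockEdge.classificationError_le {m : ℝ}
    {τ : Fin n → ℕ} (h : NoInterBlockEdge G σ) (hτ : IsComponentLabelling G m τ)
    (Z Y : Finset (Fin n)) (hZ : ∀ i ∉ Z, 2 * m ≤ ((block σ (σ i)).card : ℝ))
    (hY : ∀ i ∉ Y, ∀ S ⊆ block σ (σ i), i ∈ S → IsCluster G (block σ (σ i)) S →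
      (block σ (σ i)).card < 2 * S.card) :
    classificationError (fun i => (σ i : ℕ)) τ ≤ Z.card + Y.card := by
  classical
  have hmaj : ∀ i ∉ Y, (block σ (σ i)).card < 2 * (nodeComponent G i).card := fun i hi =>
    hY i hi _ (h.nodeComponent_subset i) (by simp) (isCluster_nodeComponent _ i)
  have hlarge : ∀ i ∈ (Z ∪ Y)ᶜ, InLargeComponent G m i := fun i hi => by
    rw [Finset.mem_compl, Finset.mem_union, not_or] at hi
    rw [inLargeComponent_iff]
    have h1 := hZ i hi.1
    have h2 : ((block σ (σ i)).card : ℝ) < 2 * (nodeComponent G i).card := by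
      exact_mod_cast hmaj i hi.2
    linarith
  have := classificationError_le_card_compl (σ := fun i => (σ i : ℕ)) (τ := τ) (Z ∪ Y)ᶜ
    fun i hi j hj => by
      rw [hτ i j (hlarge i hi) (hlarge j hj), Fin.val_inj]
      rw [Finset.mem_compl, Finset.mem_union, not_or] at hi hj
      exact ⟨h.eq_of_reachable, fun hij =>
        h.reachable_of_majority hij (hmaj i hi.2) (hmaj j hj.2)⟩
  rw [compl_compl] at this
  exact this.trans (Finset.card_union_le _ _)

/-- If no union of components holds a proportion of the block between `δ` and `1 - δ`, some
component holds a proportion of at least `1 - δ`: otherwise components could be added one by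
one until the union has a proportion in that range. -/
theorem NoInterBlockEdge.exists_giant (h : NoInterBlockEdge G σ) {k : Fin K} {δ : ℝ}
    (hδ3 : δ ≤ 1 / 3) (hne : (block σ k).Nonempty)
    (hcut : ∀ U ⊆ block σ k, δ * (block σ k).card ≤ U.card →
      (U.card : ℝ) ≤ (1 - δ) * (block σ k).card → ¬ IsSeparated G (block σ k) U) :
    ∃ i, σ i = k ∧ (1 - δ) * (block σ k).card ≤ (nodeComponent G i).card := by
  classical
  by_contra! hno
  set B := block σ k with hB
  have hBpos : (0 : ℝ) < B.card := by exact_mod_cast hne.card_pos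
  have hcompB : ∀ i, σ i = k → nodeComponent G i ⊆ B := fun i hi => by
    rw [hB, ← hi]; exact h.nodeComponent_subset i
  have hsmall : ∀ i, σ i = k → ((nodeComponent G i).card : ℝ) < δ * B.card := fun i hi => by
    by_contra! hge
    exact hcut _ (hcompB i hi) hge (hno i hi).le (isSeparated_nodeComponent _ i)
  -- a largest separated set among those of proportion at most `1 - δ`
  let F : Finset (Finset (Fin n)) := B.powerset.filter fun U =>
    IsSeparated G B U ∧ (U.card : ℝ) ≤ (1 - δ) * B.card
  have hF : F.Nonempty := ⟨∅, by
    simp only [F, Finset.mem_filter, Finset.empty_mem_powerset, true_and, Finset.card_empty,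
      Nat.cast_zero]
    exact ⟨fun i hi => absurd hi (Finset.notMem_empty i), by nlinarith⟩⟩
  obtain ⟨U, hU, hmax⟩ := F.exists_max_image Finset.card hF
  obtain ⟨hUB, hsep, hle⟩ := by
    simpa only [F, Finset.mem_filter, Finset.mem_powerset] using hU
  have hlt : (U.card : ℝ) < δ * B.card := by
    by_contra! hge
    exact hcut U hUB hge hle hsep
  obtain ⟨j, hjB, hjU⟩ : ∃ j ∈ B, j ∉ U := by
    by_contra! hall
    have : (B.card : ℝ) ≤ U.card := by exact_mod_cast Finset.card_le_card hall
    nlinarith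
  have hjk : σ j = k := mem_block.1 hjB
  have hcard : ((U ∪ nodeComponent G j).card : ℝ) ≤ U.card + (nodeComponent G j).card := by
    exact_mod_cast Finset.card_union_le _ _
  have hmem : U ∪ nodeComponent G j ∈ F := by
    simp only [F, Finset.mem_filter, Finset.mem_powerset]
    refine ⟨Finset.union_subset hUB (hcompB j hjk), ?_, ?_⟩
    · intro a ha b hb hab
      rw [Finset.mem_sdiff, Finset.mem_union, not_or] at hb
      rcases Finset.mem_union.1 ha with ha | ha
      · exact hsep a ha b (Finset.mem_sdiff.2 ⟨hb.1, hb.2.1⟩) hab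
      · exact isSeparated_nodeComponent B j a ha b (Finset.mem_sdiff.2 ⟨hb.1, hb.2.2⟩) hab
    · have := hsmall j hjk
      nlinarith
  have := Finset.eq_of_subset_of_card_le Finset.subset_union_left (hmax _ hmem)
  exact hjU (this ▸ Finset.mem_union_right U (mem_nodeComponent.2 (SimpleGraph.Reachable.refl j)))

end Blocks

/-! ### Edge probabilities -/

namespace TemporalSBM

variable (M : TemporalSBM)

/-- The node pairs that index the observations. -/
abbrev Pair : Type := {p : Fin M.N × Fin M.N // p.1 < p.2}

instance : IsProbabilityMeasure M.law := by unfold law; infer_instance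

theorem persistProb_nonneg (k l : Fin M.K) : 0 ≤ M.persistProb k l := ENNReal.toReal_nonneg

theorem persistProb_le_one (k l : Fin M.K) : M.persistProb k l ≤ 1 :=
  ENNReal.toReal_le_of_le_ofReal zero_le_one (by simpa using PMF.coe_le_one _ _)

variable {M} in
theorem persistentGraph_adj (x : M.Obs) (p : M.Pair) :
    (M.persistentGraph x).Adj p.1.1 p.1.2 ↔ x p = fun _ => true := by
  obtain ⟨⟨i, j⟩, hij⟩ := p
  simp only [persistentGraph, SimpleGraph.iInf_adj, snapshot, SimpleGraph.fromRel_adj]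
  constructor
  · rintro ⟨h, -⟩
    funext t
    rcases (h t).2 with ⟨_, hx⟩ | ⟨h', -⟩
    · exact hx
    · exact absurd h' (lt_asymm hij)
  · intro h
    exact ⟨fun t => ⟨hij.ne, Or.inl ⟨hij, by rw [h]⟩⟩, hij.ne⟩

/-- Prescribed edges and prescribed non-edges are independent events. -/
theorem law_cylinder {F A : Finset M.Pair} (hFA : Disjoint F A) {q : ℝ}
    (hF : ∀ p ∈ F, M.persistProb (M.σ p.1.1) (M.σ p.1.2) = q)
    (hA : ∀ p ∈ A, M.persistProb (M.σ p.1.1) (M.σ p.1.2) = q) :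
    M.law.real {x | (∀ p ∈ F, x p = fun _ => true) ∧ ∀ p ∈ A, x p ≠ fun _ => true} =
      q ^ F.card * (1 - q) ^ A.card := by
  classical
  let s : ∀ _ : M.Pair, Set (Fin M.T → Bool) := fun p =>
    if p ∈ F then {fun _ => true} else if p ∈ A then {fun _ => true}ᶜ else Set.univ
  have hs : {x : M.Obs | (∀ p ∈ F, x p = fun _ => true) ∧ ∀ p ∈ A, x p ≠ fun _ => true} =
      Set.univ.pi s := by
    ext x
    simp only [Set.mem_ofPred_eq, Set.mem_univ_pi, s]
    constructor
    · rintro ⟨h1, h2⟩ p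
      split_ifs with hp hp'
      · exact h1 p hp
      · exact h2 p hp'
      · trivial
    · intro h
      refine ⟨fun p hp => ?_, fun p hp => ?_⟩
      · have := h p
        rwa [if_pos hp] at this
      · have := h p
        rwa [if_neg (Finset.disjoint_right.1 hFA hp), if_pos hp] at this
  have hone : ∀ p : M.Pair, (M.f (M.σ p.1.1) (M.σ p.1.2)).toMeasure.real {fun _ => true} =
      M.persistProb (M.σ p.1.1) (M.σ p.1.2) := fun p => by
    rw [measureReal_def, PMF.toMeasure_apply_singleton _ _ (measurableSet_singleton _)]
    rfl
  have hfac : ∀ p : M.Pair, (M.f (M.σ p.1.1) (M.σ p.1.2)).toMeasure.real (s p) =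
      (if p ∈ F then q else 1) * (if p ∈ A then 1 - q else 1) := by
    intro p
    by_cases hp : p ∈ F
    · have hp' : p ∉ A := Finset.disjoint_left.1 hFA hp
      simp only [s, if_pos hp, if_neg hp', mul_one]
      rw [hone, hF p hp]
    · by_cases hp' : p ∈ A
      · simp only [s, if_neg hp, if_pos hp', one_mul]
        rw [probReal_compl_eq_one_sub (measurableSet_singleton _), hone, hA p hp']
      · simp [s, hp, hp']
  rw [hs, law, measureReal_def, Measure.pi_pi, ENNReal.toReal_prod]
  simp only [← measureReal_def]
  rw [Finset.prod_congr rfl fun p _ => hfac p, Finset.prod_mul_distrib,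
    Finset.prod_ite_mem, Finset.prod_ite_mem, Finset.univ_inter, Finset.univ_inter,
    Finset.prod_const, Finset.prod_const]

theorem law_edge (p : M.Pair) :
    M.law.real {x | x p = fun _ => true} = M.persistProb (M.σ p.1.1) (M.σ p.1.2) := by
  have := M.law_cylinder (F := {p}) (A := ∅) (Finset.disjoint_empty_right _)
    (q := M.persistProb (M.σ p.1.1) (M.σ p.1.2)) (by simp) (by simp)
  simpa using this

/-- The event that there is an edge between different blocks is small by a union bound over
the node pairs. -/
theorem law_not_noInterBlockEdge_le {ε : ℝ} (hε : 0 ≤ ε)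
    (h : ∀ k l : Fin M.K, k ≠ l → (M.N : ℝ) ^ 2 * M.persistProb k l ≤ ε) :
    M.law.real {x | ¬ NoInterBlockEdge (M.persistentGraph x) M.σ} ≤ ε := by
  classical
  let P : Finset M.Pair := Finset.univ.filter fun p => M.σ p.1.1 ≠ M.σ p.1.2
  have hsub : {x | ¬ NoInterBlockEdge (M.persistentGraph x) M.σ} ⊆
      ⋃ p ∈ P, {x : M.Obs | x p = fun _ => true} := by
    intro x hx
    simp only [NoInterBlockEdge, Set.mem_ofPred_eq, not_forall] at hx
    obtain ⟨i, j, hadj, hne⟩ := hx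
    simp only [Set.mem_iUnion, Set.mem_ofPred_eq, P, Finset.mem_filter, Finset.mem_univ, true_and]
    rcases lt_or_gt_of_ne hadj.ne with hij | hij
    · exact ⟨⟨(i, j), hij⟩, hne, (persistentGraph_adj x ⟨(i, j), hij⟩).1 hadj⟩
    · exact ⟨⟨(j, i), hij⟩, Ne.symm hne, (persistentGraph_adj x ⟨(j, i), hij⟩).1 hadj.symm⟩
  have hcard : (P.card : ℝ) ≤ (M.N : ℝ) ^ 2 := by
    have h1 : P.card ≤ Fintype.card M.Pair := Finset.card_le_univ P
    have h2 : Fintype.card M.Pair ≤ Fintype.card (Fin M.N × Fin M.N) :=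
      Fintype.card_subtype_le _
    rw [Fintype.card_prod, Fintype.card_fin, ← sq] at h2
    exact_mod_cast h1.trans h2
  rcases Nat.eq_zero_or_pos M.N with hN | hN
  · have hP : P = ∅ := by
      rw [hN] at hcard
      simpa using hcard
    have := measureReal_mono (μ := M.law) hsub (measure_ne_top _ _)
    rw [hP] at this
    simp only [Finset.notMem_empty, Set.iUnion_of_empty, Set.iUnion_empty,
      measureReal_empty] at this
    exact this.trans hε
  have hN' : (0 : ℝ) < (M.N : ℝ) ^ 2 := by positivity
  calc _ ≤ M.law.real (⋃ p ∈ P, {x : M.Obs | x p = fun _ => true}) :=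
        measureReal_mono hsub (measure_ne_top _ _)
    _ ≤ ∑ p ∈ P, M.law.real {x : M.Obs | x p = fun _ => true} :=
        measureReal_biUnion_finset_le _ _
    _ ≤ ∑ _p ∈ P, ε / (M.N : ℝ) ^ 2 := Finset.sum_le_sum fun p hp => by
        rw [law_edge, le_div_iff₀ hN', mul_comm]
        exact h _ _ (Finset.mem_filter.1 hp).2
    _ = P.card * (ε / (M.N : ℝ) ^ 2) := by rw [Finset.sum_const, nsmul_eq_mul]
    _ ≤ (M.N : ℝ) ^ 2 * (ε / (M.N : ℝ) ^ 2) :=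
        mul_le_mul_of_nonneg_right hcard (by positivity)
    _ = ε := by field_simp

/-! ### The probability of a cluster -/

/-- The pairs of nodes of `S`. -/
def innerPairs (S : Finset (Fin M.N)) : Finset M.Pair :=
  Finset.univ.filter fun p => p.1.1 ∈ S ∧ p.1.2 ∈ S

/-- The pairs of a node of `U` and a node of `B \ U`. -/
def cutPairs (B U : Finset (Fin M.N)) : Finset M.Pair :=
  Finset.univ.filter fun p =>
    (p.1.1 ∈ U ∧ p.1.2 ∈ B \ U) ∨ (p.1.1 ∈ B \ U ∧ p.1.2 ∈ U)

variable {M}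

theorem card_innerPairs_le (S : Finset (Fin M.N)) :
    (M.innerPairs S).card ≤ S.card * (S.card - 1) := by
  rw [Nat.mul_sub_one, ← Finset.offDiag_card]
  refine Finset.card_le_card_of_injOn Subtype.val (fun p hp => ?_)
    Subtype.val_injective.injOn
  obtain ⟨h1, h2⟩ := (Finset.mem_filter.1 (Finset.mem_coe.1 hp)).2
  exact Finset.mem_coe.2 (Finset.mem_offDiag.2 ⟨h1, h2, p.2.ne⟩)

theorem le_card_cutPairs {B U : Finset (Fin M.N)} (hUB : U ⊆ B) :
    U.card * (B.card - U.card) ≤ (M.cutPairs B U).card := by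
  rw [← Finset.card_sdiff_of_subset hUB, ← Finset.card_product]
  have hne : ∀ q ∈ U ×ˢ (B \ U), q.1 ≠ q.2 := fun q hq heq => by
    obtain ⟨h1, h2⟩ := Finset.mem_product.1 hq
    exact (Finset.mem_sdiff.1 h2).2 (heq ▸ h1)
  refine Finset.card_le_card_of_forall_subsingleton
    (fun q p => p.1 = q ∨ p.1 = q.swap) (fun q hq => ?_) fun p _ q hq q' hq' => ?_
  · obtain ⟨h1, h2⟩ := Finset.mem_product.1 hq
    rcases lt_or_gt_of_ne (hne q hq) with h | h
    · exact ⟨⟨q, h⟩, Finset.mem_filter.2 ⟨Finset.mem_univ _, Or.inl ⟨h1, h2⟩⟩, Or.inl rfl⟩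
    · exact ⟨⟨q.swap, h⟩, Finset.mem_filter.2 ⟨Finset.mem_univ _, Or.inr ⟨h2, h1⟩⟩, Or.inr rfl⟩
  · obtain ⟨hq, h⟩ := hq
    obtain ⟨hq', h'⟩ := hq'
    simp only [Finset.mem_product, Finset.mem_sdiff] at hq hq'
    rcases h with h | h <;> rcases h' with h' | h'
    · exact h.symm.trans h'
    · have := h.symm.trans h'
      rw [this] at hq
      exact absurd hq'.1 hq.2.2
    · have := h'.symm.trans h
      rw [this] at hq'
      exact absurd hq.1 hq'.2.2
    · exact Prod.swap_injective (h.symm.trans h')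

theorem isSeparated_iff (x : M.Obs) (B U : Finset (Fin M.N)) :
    IsSeparated (M.persistentGraph x) B U ↔ ∀ p ∈ M.cutPairs B U, x p ≠ fun _ => true := by
  constructor
  · intro h p hp hx
    have hadj := (persistentGraph_adj x p).2 hx
    rcases (Finset.mem_filter.1 hp).2 with ⟨h1, h2⟩ | ⟨h1, h2⟩
    · exact h _ h1 _ h2 hadj
    · exact h _ h2 _ h1 hadj.symm
  · intro h i hi j hj hadj
    rcases lt_or_gt_of_ne hadj.ne with hij | hij
    · exact h ⟨(i, j), hij⟩ (Finset.mem_filter.2 ⟨Finset.mem_univ _, Or.inl ⟨hi, hj⟩⟩)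
        ((persistentGraph_adj x ⟨(i, j), hij⟩).1 hadj)
    · exact h ⟨(j, i), hij⟩ (Finset.mem_filter.2 ⟨Finset.mem_univ _, Or.inr ⟨hj, hi⟩⟩)
        ((persistentGraph_adj x ⟨(j, i), hij⟩).1 hadj.symm)

/-- A connected set of `s` nodes carries at least `s - 1` edges. -/
theorem exists_edges_of_connected {x : M.Obs} {S : Finset (Fin M.N)}
    (h : ((M.persistentGraph x).induce (S : Set (Fin M.N))).Connected) :
    ∃ F ∈ (M.innerPairs S).powersetCard (S.card - 1), ∀ p ∈ F, x p = fun _ => true := by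
  classical
  set H := (M.persistentGraph x).induce (S : Set (Fin M.N)) with hH
  let P := (M.innerPairs S).filter fun p => x p = fun _ => true
  have hedge : ∀ e : H.edgeSet, ∃ p ∈ P, s(p.1.1, p.1.2) = Sym2.map Subtype.val e.1 := by
    rintro ⟨e, he⟩
    induction e using Sym2.ind with
    | h a b =>
      have hadj : (M.persistentGraph x).Adj a b := he
      rcases lt_or_gt_of_ne hadj.ne with hab | hab
      · exact ⟨⟨(a, b), hab⟩, Finset.mem_filter.2 ⟨Finset.mem_filter.2
          ⟨Finset.mem_univ _, a.2, b.2⟩, (persistentGraph_adj x ⟨(a, b), hab⟩).1 hadj⟩, rfl⟩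
      · exact ⟨⟨(b, a), hab⟩, Finset.mem_filter.2 ⟨Finset.mem_filter.2
          ⟨Finset.mem_univ _, b.2, a.2⟩,
          (persistentGraph_adj x ⟨(b, a), hab⟩).1 hadj.symm⟩, Sym2.eq_swap⟩
  choose g hgP hg using hedge
  have hinj : Function.Injective g := fun e e' hee => by
    have := (hg e).symm.trans ((congrArg (fun p : M.Pair => s(p.1.1, p.1.2)) hee).trans (hg e'))
    exact Subtype.ext (Sym2.map.injective Subtype.val_injective this)
  have hcard : Nat.card H.edgeSet ≤ P.card := by
    rw [Nat.card_eq_fintype_card, ← Finset.card_univ]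
    exact Finset.card_le_card_of_injOn g (fun e _ => hgP e) hinj.injOn
  have hvert := h.card_vert_le_card_edgeSet_add_one
  have hS : Nat.card (S : Set (Fin M.N)) = S.card := by simp
  obtain ⟨F, hFP, hF⟩ := Finset.exists_subset_card_eq (s := P) (n := S.card - 1) (by omega)
  exact ⟨F, Finset.mem_powersetCard.2 ⟨hFP.trans (Finset.filter_subset _ _), hF⟩,
    fun p hp => (Finset.mem_filter.1 (hFP hp)).2⟩

theorem persistProb_of_mem_block {k : Fin M.K} {p : M.Pair} (h1 : p.1.1 ∈ block M.σ k)
    (h2 : p.1.2 ∈ block M.σ k) :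
    M.persistProb (M.σ p.1.1) (M.σ p.1.2) = M.persistProb k k := by
  rw [mem_block.1 h1, mem_block.1 h2]

theorem persistProb_of_mem_cutPairs {k : Fin M.K} {U : Finset (Fin M.N)}
    (hU : U ⊆ block M.σ k) {p : M.Pair} (hp : p ∈ M.cutPairs (block M.σ k) U) :
    M.persistProb (M.σ p.1.1) (M.σ p.1.2) = M.persistProb k k := by
  rcases (Finset.mem_filter.1 hp).2 with ⟨h1, h2⟩ | ⟨h1, h2⟩
  · exact persistProb_of_mem_block (hU h1) (Finset.sdiff_subset h2)
  · exact persistProb_of_mem_block (Finset.sdiff_subset h1) (hU h2)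

theorem law_isSeparated_le {k : Fin M.K} {U : Finset (Fin M.N)} (hU : U ⊆ block M.σ k) :
    M.law.real {x | IsSeparated (M.persistentGraph x) (block M.σ k) U} ≤
      (1 - M.persistProb k k) ^ (U.card * ((block M.σ k).card - U.card)) := by
  have := M.law_cylinder (F := ∅) (A := M.cutPairs (block M.σ k) U)
    (Finset.disjoint_empty_left _) (q := M.persistProb k k) (by simp)
    fun p hp => persistProb_of_mem_cutPairs hU hp
  simp only [isSeparated_iff]
  simp only [Finset.notMem_empty, IsEmpty.forall_iff, implies_true, true_and, Finset.card_empty,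
    pow_zero, one_mul] at this
  rw [this]
  exact pow_le_pow_of_le_one (by linarith [M.persistProb_le_one k k])
    (by linarith [M.persistProb_nonneg k k]) (le_card_cutPairs hU)

/-- Union bound over the sets of `s - 1` pairs that may carry a spanning tree of `S`. -/
theorem law_isCluster_le {k : Fin M.K} {S : Finset (Fin M.N)} (hS : S ⊆ block M.σ k) :
    M.law.real {x | IsCluster (M.persistentGraph x) (block M.σ k) S} ≤
      (S.card * (S.card - 1)).choose (S.card - 1) * (M.persistProb k k ^ (S.card - 1) *
        (1 - M.persistProb k k) ^ (S.card * ((block M.σ k).card - S.card))) := by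
  classical
  set q := M.persistProb k k
  have hq0 : 0 ≤ q := M.persistProb_nonneg k k
  have hq1 : 0 ≤ 1 - q := by linarith [M.persistProb_le_one k k]
  let C := M.cutPairs (block M.σ k) S
  let 𝓕 := (M.innerPairs S).powersetCard (S.card - 1)
  have hsub : {x | IsCluster (M.persistentGraph x) (block M.σ k) S} ⊆
      ⋃ F ∈ 𝓕, {x : M.Obs | (∀ p ∈ F, x p = fun _ => true) ∧ ∀ p ∈ C, x p ≠ fun _ => true} := by
    rintro x ⟨hconn, hsep⟩
    obtain ⟨F, hF, hFx⟩ := exists_edges_of_connected hconn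
    exact Set.mem_biUnion hF ⟨hFx, (isSeparated_iff _ _ _).1 hsep⟩
  have hterm : ∀ F ∈ 𝓕, M.law.real
      {x : M.Obs | (∀ p ∈ F, x p = fun _ => true) ∧ ∀ p ∈ C, x p ≠ fun _ => true} ≤
      q ^ (S.card - 1) * (1 - q) ^ (S.card * ((block M.σ k).card - S.card)) := by
    intro F hF
    obtain ⟨hFin, hFcard⟩ := Finset.mem_powersetCard.1 hF
    rw [M.law_cylinder (q := q), hFcard]
    · exact mul_le_mul_of_nonneg_left (pow_le_pow_of_le_one hq1 (by linarith)
        (le_card_cutPairs hS)) (by positivity)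
    · refine Finset.disjoint_left.2 fun p hpF hpC => ?_
      obtain ⟨h1, h2⟩ := (Finset.mem_filter.1 (hFin hpF)).2
      rcases (Finset.mem_filter.1 hpC).2 with ⟨-, h⟩ | ⟨h, -⟩
      · exact (Finset.mem_sdiff.1 h).2 h2
      · exact (Finset.mem_sdiff.1 h).2 h1
    · intro p hp
      obtain ⟨h1, h2⟩ := (Finset.mem_filter.1 (hFin hp)).2
      exact persistProb_of_mem_block (hS h1) (hS h2)
    · exact fun p hp => persistProb_of_mem_cutPairs hS hp
  have hcard : 𝓕.card ≤ (S.card * (S.card - 1)).choose (S.card - 1) := by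
    rw [Finset.card_powersetCard]
    exact Nat.choose_le_choose _ (card_innerPairs_le S)
  calc _ ≤ M.law.real (⋃ F ∈ 𝓕,
        {x : M.Obs | (∀ p ∈ F, x p = fun _ => true) ∧ ∀ p ∈ C, x p ≠ fun _ => true}) :=
        measureReal_mono hsub (measure_ne_top _ _)
    _ ≤ ∑ F ∈ 𝓕, _ := measureReal_biUnion_finset_le _ _
    _ ≤ 𝓕.card • _ := Finset.sum_le_card_nsmul _ _ _ hterm
    _ ≤ _ := by
        rw [nsmul_eq_mul]
        exact mul_le_mul_of_nonneg_right (by exact_mod_cast hcard) (by positivity)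

end TemporalSBM

/-! ### Estimates for the expected size of minority clusters -/

/-- A bound for the expected number of nodes in clusters of size `s`, in a block of `n` nodes
with edge probability `p`. -/
noncomputable def clusterMass (n s : ℕ) (p : ℝ) : ℝ :=
  n.choose s * (s * ((s * (s - 1)).choose (s - 1) * (p ^ (s - 1) * (1 - p) ^ (s * (n - s)))))

theorem clusterMass_le {n s : ℕ} {p : ℝ} (hp0 : 0 ≤ p) (hp1 : p ≤ 1) (hs : 1 ≤ s)
    (hsn : s ≤ n) :
    clusterMass n s p ≤ n * Real.exp (2 * s) * (n * p) ^ (s - 1) *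
      Real.exp (-(p * (s * (n - s)))) := by
  obtain ⟨t, rfl⟩ : ∃ t, s = t + 1 := ⟨s - 1, by omega⟩
  simp only [Nat.add_sub_cancel, clusterMass]
  have h1 : (n.choose (t + 1) : ℝ) ≤ (n : ℝ) ^ (t + 1) / (t + 1).factorial :=
    Nat.choose_le_pow_div _ _
  have h2 : (((t + 1) * t).choose t : ℝ) ≤ ((t + 1 : ℕ) : ℝ) ^ t * Real.exp t := by
    calc (((t + 1) * t).choose t : ℝ) ≤ (((t + 1) * t : ℕ) : ℝ) ^ t / t.factorial :=
          Nat.choose_le_pow_div _ _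
      _ = ((t + 1 : ℕ) : ℝ) ^ t * ((t : ℝ) ^ t / t.factorial) := by
          rw [Nat.cast_mul, mul_pow, mul_div_assoc]
      _ ≤ _ := mul_le_mul_of_nonneg_left
          (Real.pow_div_factorial_le_exp _ (Nat.cast_nonneg _) _) (by positivity)
  have h3 : ((t + 1 : ℕ) : ℝ) ^ (t + 1) / (t + 1).factorial ≤ Real.exp (t + 1 : ℕ) :=
    Real.pow_div_factorial_le_exp _ (Nat.cast_nonneg _) _
  have h4 : (1 - p) ^ ((t + 1) * (n - (t + 1))) ≤
      Real.exp (-(p * ((t + 1 : ℕ) * (n - (t + 1 : ℕ))))) := by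
    calc (1 - p) ^ ((t + 1) * (n - (t + 1))) ≤ Real.exp (-p) ^ ((t + 1) * (n - (t + 1))) :=
          pow_le_pow_left₀ (by linarith) (Real.one_sub_le_exp_neg p) _
      _ = _ := by
          rw [← Real.exp_nat_mul]
          push_cast [Nat.cast_sub hsn]
          ring_nf
  have h5 : Real.exp (t + 1 : ℕ) * Real.exp t ≤ Real.exp (2 * (t + 1 : ℕ)) := by
    rw [← Real.exp_add, Real.exp_le_exp]
    push_cast
    linarith
  have hq : (0 : ℝ) ≤ (1 - p) ^ ((t + 1) * (n - (t + 1))) := pow_nonneg (by linarith) _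
  calc (n.choose (t + 1) : ℝ) * ((t + 1 : ℕ) * (((t + 1) * t).choose t * (p ^ t *
        (1 - p) ^ ((t + 1) * (n - (t + 1))))))
      ≤ (n : ℝ) ^ (t + 1) / (t + 1).factorial * ((t + 1 : ℕ) *
        (((t + 1 : ℕ) : ℝ) ^ t * Real.exp t * (p ^ t *
          Real.exp (-(p * ((t + 1 : ℕ) * (n - (t + 1 : ℕ)))))))) := by gcongr
    _ = n * (((t + 1 : ℕ) : ℝ) ^ (t + 1) / (t + 1).factorial * Real.exp t) * (n * p) ^ t *
        Real.exp (-(p * ((t + 1 : ℕ) * (n - (t + 1 : ℕ))))) := by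
        rw [mul_pow]
        ring
    _ ≤ n * (Real.exp (t + 1 : ℕ) * Real.exp t) * (n * p) ^ t *
        Real.exp (-(p * ((t + 1 : ℕ) * (n - (t + 1 : ℕ))))) := by gcongr
    _ ≤ _ := by gcongr

/-- The ratio of the geometric series that bounds the expected size of minority clusters in a
block with mean degree `c`. -/
noncomputable def clusterRatio (c : ℝ) : ℝ := Real.exp 2 * (c * Real.exp (-(c / 4)))

theorem clusterRatio_nonneg {c : ℝ} (hc : 0 ≤ c) : 0 ≤ clusterRatio c := by
  unfold clusterRatio; positivity

theorem clusterRatio_pow (c : ℝ) (s : ℕ) :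
    clusterRatio c ^ s = Real.exp (2 * s) * c ^ s * Real.exp (-(s * (c / 4))) := by
  rw [clusterRatio, mul_pow, mul_pow, ← Real.exp_nat_mul, ← Real.exp_nat_mul, mul_comm 2,
    mul_neg, mul_assoc]

theorem eventually_clusterRatio_le {η : ℝ} (hη : 0 < η) :
    ∀ᶠ c in atTop, clusterRatio c ≤ η := by
  have h1 : Tendsto (fun c : ℝ => c / 4) atTop atTop := tendsto_id.atTop_div_const (by norm_num)
  have h2 := ((Real.tendsto_pow_mul_exp_neg_atTop_nhds_zero 1).comp h1).const_mul
    (4 * Real.exp 2)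
  rw [mul_zero] at h2
  filter_upwards [h2.eventually_le_const hη] with c hc
  refine le_trans (le_of_eq ?_) hc
  simp only [clusterRatio, Function.comp, pow_one]
  ring

theorem clusterMass_le_pow {n s : ℕ} {p : ℝ} (hp0 : 0 ≤ p) (hp1 : p ≤ 1) (hs : 1 ≤ s)
    (hsn : 2 * s ≤ n) (hc : 1 ≤ n * p) :
    clusterMass n s p ≤ n * clusterRatio (n * p) ^ s := by
  refine (clusterMass_le hp0 hp1 hs (by omega)).trans ?_
  have hsn' : 2 * (s : ℝ) ≤ n := by exact_mod_cast hsn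
  have h1 : (n * p) ^ (s - 1) ≤ (n * p) ^ s := pow_le_pow_right₀ hc (Nat.sub_le _ _)
  have h2 : s * (n * p / 4) ≤ p * (s * (n - s)) := by
    have : (0 : ℝ) ≤ p * s * (3 * n / 4 - s) :=
      mul_nonneg (by positivity) (by linarith [Nat.cast_nonneg (α := ℝ) s])
    nlinarith
  calc n * Real.exp (2 * s) * (n * p) ^ (s - 1) * Real.exp (-(p * (s * (n - s))))
      ≤ n * Real.exp (2 * s) * (n * p) ^ s * Real.exp (-(s * (n * p / 4))) := by gcongr
    _ = n * clusterRatio (n * p) ^ s := by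
        rw [clusterRatio_pow]
        ring

/-- For small `s` the factor `exp (-n p)`, the order of the probability that a node is isolated,
is needed; this is what sets the connectivity threshold. -/
theorem clusterMass_le_exp_mul_pow {n s : ℕ} {p : ℝ} (hp0 : 0 ≤ p) (hp1 : p ≤ 1) (hs : 1 ≤ s)
    (hsn : 2 * s ≤ n) (hn : 6 ≤ n) :
    clusterMass n s p ≤
      Real.exp 3 * (n * Real.exp (-(n * p))) * clusterRatio (n * p) ^ (s - 1) := by
  refine (clusterMass_le hp0 hp1 hs (by omega)).trans ?_
  obtain ⟨t, rfl⟩ : ∃ t, s = t + 1 := ⟨s - 1, by omega⟩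
  have hsn' : 2 * ((t : ℝ) + 1) ≤ n := by exact_mod_cast hsn
  have hn' : (6 : ℝ) ≤ n := by exact_mod_cast hn
  have key : (n - 1 + t * (n / 4) : ℝ) ≤ (t + 1) * (n - (t + 1)) := by
    rcases Nat.lt_or_ge t 2 with ht | ht
    · interval_cases t <;> norm_num; linarith
    · have ht' : (2 : ℝ) ≤ t := by exact_mod_cast ht
      nlinarith [mul_nonneg (by positivity : (0 : ℝ) ≤ t + 1) (sub_nonneg.2 hsn')]
  have h2 : n * p - 1 + t * (n * p / 4) ≤ p * ((t + 1 : ℕ) * (n - (t + 1 : ℕ))) := by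
    have := mul_le_mul_of_nonneg_left key hp0
    push_cast
    nlinarith
  simp only [Nat.add_sub_cancel]
  calc n * Real.exp (2 * (t + 1 : ℕ)) * (n * p) ^ t *
        Real.exp (-(p * ((t + 1 : ℕ) * (n - (t + 1 : ℕ)))))
      ≤ n * Real.exp (2 * (t + 1 : ℕ)) * (n * p) ^ t *
        Real.exp (-(n * p - 1 + t * (n * p / 4))) := by gcongr
    _ = Real.exp 3 * (n * Real.exp (-(n * p))) * clusterRatio (n * p) ^ t := by
        rw [clusterRatio_pow]
        have e1 : Real.exp (2 * (t + 1 : ℕ)) * Real.exp (-(n * p - 1 + t * (n * p / 4))) =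
            Real.exp 3 * Real.exp (-(n * p)) *
              (Real.exp (2 * t) * Real.exp (-(t * (n * p / 4)))) := by
          rw [← Real.exp_add, ← Real.exp_add, ← Real.exp_add, ← Real.exp_add]
          push_cast
          ring_nf
        linear_combination (n * (n * p) ^ t) * e1

namespace TemporalSBM

variable (M : TemporalSBM)

/-- The sets of at least `a` nodes that hold at most half of block `k`. -/
def minoritySets (k : Fin M.K) (a : ℕ) : Finset (Finset (Fin M.N)) :=
  (block M.σ k).powerset.filter fun S => a ≤ S.card ∧ 2 * S.card ≤ (block M.σ k).card

variable {M}

theorem mem_minoritySets {k : Fin M.K} {a : ℕ} {S : Finset (Fin M.N)} :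
    S ∈ M.minoritySets k a ↔
      S ⊆ block M.σ k ∧ a ≤ S.card ∧ 2 * S.card ≤ (block M.σ k).card := by
  simp [minoritySets]

theorem sum_minoritySets_le {k : Fin M.K} {a : ℕ} {A r : ℝ} (hA : 0 ≤ A) (hr0 : 0 ≤ r)
    (hr : r ≤ 1 / 2)
    (hmass : ∀ s, a ≤ s → 2 * s ≤ M.blockSize k →
      clusterMass (M.blockSize k) s (M.persistProb k k) ≤ A * r ^ (s - a)) :
    ∑ S ∈ M.minoritySets k a,
      (S.card : ℝ) * M.law.real {x | IsCluster (M.persistentGraph x) (block M.σ k) S} ≤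
      2 * A := by
  classical
  set n := M.blockSize k with hn
  have hB : (block M.σ k).card = n := rfl
  set p := M.persistProb k k
  let g : ℕ → ℝ := fun s => s * ((s * (s - 1)).choose (s - 1) *
    (p ^ (s - 1) * (1 - p) ^ (s * (n - s))))
  calc _ ≤ ∑ S ∈ M.minoritySets k a, g S.card := Finset.sum_le_sum fun S hS =>
        mul_le_mul_of_nonneg_left (law_isCluster_le (mem_minoritySets.1 hS).1)
          (Nat.cast_nonneg _)
    _ = ∑ S ∈ (block M.σ k).powerset,
          if a ≤ S.card ∧ 2 * S.card ≤ n then g S.card else 0 := Finset.sum_filter _ _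
    _ = ∑ s ∈ Finset.range (n + 1), n.choose s • if a ≤ s ∧ 2 * s ≤ n then g s else 0 := by
        rw [Finset.sum_powerset_apply_card fun s => if a ≤ s ∧ 2 * s ≤ n then g s else 0, hB]
    _ ≤ ∑ s ∈ Finset.range (n + 1), if a ≤ s then A * r ^ (s - a) else 0 := by
        refine Finset.sum_le_sum fun s _ => ?_
        rw [nsmul_eq_mul]
        by_cases h1 : a ≤ s
        · by_cases h2 : 2 * s ≤ n
          · rw [if_pos ⟨h1, h2⟩, if_pos h1]
            exact hmass s h1 h2
          · rw [if_neg fun h => h2 h.2, if_pos h1, mul_zero]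
            positivity
        · rw [if_neg fun h => h1 h.1, if_neg h1, mul_zero]
    _ = ∑ s ∈ Finset.Ico a (n + 1), A * r ^ (s - a) := by
        rw [← Finset.sum_filter]
        congr 1
        ext s
        simp only [Finset.mem_filter, Finset.mem_range, Finset.mem_Ico]
        exact and_comm
    _ = A * ∑ i ∈ Finset.range (n + 1 - a), r ^ i := by
        rw [Finset.sum_Ico_eq_sum_range, Finset.mul_sum]
        simp
    _ ≤ A * ∑ i ∈ Finset.range (n + 1 - a), (1 / 2 : ℝ) ^ i := by gcongr
    _ ≤ A * 2 := mul_le_mul_of_nonneg_left (sum_geometric_two_le _) hA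
    _ = 2 * A := mul_comm _ _

/-- The expected number of nodes in minority clusters of size at least `a`. -/
theorem sum_minoritySets_le_pow {k : Fin M.K} {a : ℕ} {r : ℝ} (ha : 1 ≤ a)
    (hc : 1 ≤ M.blockSize k * M.persistProb k k)
    (hr : clusterRatio (M.blockSize k * M.persistProb k k) ≤ r) (hr' : r ≤ 1 / 2) :
    ∑ S ∈ M.minoritySets k a,
      (S.card : ℝ) * M.law.real {x | IsCluster (M.persistentGraph x) (block M.σ k) S} ≤
      2 * (M.blockSize k * r ^ a) := by
  have h0 := clusterRatio_nonneg (zero_le_one.trans hc)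
  have hr0 : 0 ≤ r := h0.trans hr
  refine sum_minoritySets_le (by positivity) hr0 hr' fun s hs hsn => ?_
  refine (clusterMass_le_pow (M.persistProb_nonneg k k) (M.persistProb_le_one k k)
    (ha.trans hs) hsn hc).trans ?_
  rw [mul_assoc, ← pow_add, Nat.add_sub_cancel' hs]
  gcongr

theorem sum_minoritySets_le_exp {k : Fin M.K} (hn : 6 ≤ M.blockSize k)
    (hr : clusterRatio (M.blockSize k * M.persistProb k k) ≤ 1 / 2) :
    ∑ S ∈ M.minoritySets k 1,
      (S.card : ℝ) * M.law.real {x | IsCluster (M.persistentGraph x) (block M.σ k) S} ≤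
      2 * (Real.exp 3 *
        (M.blockSize k * Real.exp (-(M.blockSize k * M.persistProb k k)))) :=
  sum_minoritySets_le (by positivity)
    (clusterRatio_nonneg (mul_nonneg (Nat.cast_nonneg _) (M.persistProb_nonneg k k))) hr
    fun _ hs hsn => clusterMass_le_exp_mul_pow (M.persistProb_nonneg k k)
      (M.persistProb_le_one k k) hs hsn hn

/-- Union bound for the existence of a minority cluster of size at least `a`. -/
theorem law_exists_minority_cluster_le {k : Fin M.K} {a : ℕ} (ha : 1 ≤ a) :
    M.law.real {x | ∃ S ∈ M.minoritySets k a,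
      IsCluster (M.persistentGraph x) (block M.σ k) S} ≤
    ∑ S ∈ M.minoritySets k a,
      (S.card : ℝ) * M.law.real {x | IsCluster (M.persistentGraph x) (block M.σ k) S} := by
  have hset : {x | ∃ S ∈ M.minoritySets k a, IsCluster (M.persistentGraph x) (block M.σ k) S} =
      ⋃ S ∈ M.minoritySets k a, {x | IsCluster (M.persistentGraph x) (block M.σ k) S} := by
    ext x
    simp
  rw [hset]
  refine (measureReal_biUnion_finset_le _ _).trans (Finset.sum_le_sum fun S hS => ?_)
  refine le_mul_of_one_le_left measureReal_nonneg ?_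
  exact_mod_cast ha.trans (mem_minoritySets.1 hS).2.1

/-- A block with large mean degree is unlikely to have a balanced cut without edges: the bound
`exp (-(n p δ²) n)` for each cut beats the number `2 ^ n` of cuts. -/
theorem law_exists_balanced_cut_le {k : Fin M.K} {δ : ℝ} (hδ : 0 < δ)
    (hc : 2 / δ ^ 2 ≤ M.blockSize k * M.persistProb k k) :
    M.law.real {x | ∃ U ⊆ block M.σ k, δ * (block M.σ k).card ≤ U.card ∧
      (U.card : ℝ) ≤ (1 - δ) * (block M.σ k).card ∧
      IsSeparated (M.persistentGraph x) (block M.σ k) U} ≤ Real.exp (-M.blockSize k) := by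
  classical
  set n := M.blockSize k with hn
  have hB : (block M.σ k).card = n := rfl
  set p := M.persistProb k k
  have hp0 : 0 ≤ p := M.persistProb_nonneg k k
  have hp1 : p ≤ 1 := M.persistProb_le_one k k
  rw [hB]
  let 𝓤 := (block M.σ k).powerset.filter fun U =>
    δ * n ≤ U.card ∧ (U.card : ℝ) ≤ (1 - δ) * n
  have hset : {x | ∃ U ⊆ block M.σ k, δ * n ≤ U.card ∧ (U.card : ℝ) ≤ (1 - δ) * n ∧
      IsSeparated (M.persistentGraph x) (block M.σ k) U} =
      ⋃ U ∈ 𝓤, {x | IsSeparated (M.persistentGraph x) (block M.σ k) U} := by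
    ext x
    simp [𝓤, and_assoc]
  have hterm : ∀ U ∈ 𝓤, M.law.real {x | IsSeparated (M.persistentGraph x) (block M.σ k) U} ≤
      Real.exp (-(2 * n)) := by
    intro U hU
    obtain ⟨hUB, hU1, hU2⟩ := by simpa only [𝓤, Finset.mem_filter, Finset.mem_powerset] using hU
    have hUn : U.card ≤ n := Finset.card_le_card hUB
    refine (law_isSeparated_le hUB).trans ?_
    rw [hB]
    calc (1 - p) ^ (U.card * (n - U.card)) ≤ Real.exp (-p) ^ (U.card * (n - U.card)) :=
          pow_le_pow_left₀ (by linarith) (Real.one_sub_le_exp_neg p) _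
      _ = Real.exp (-((U.card * (n - U.card)) * p)) := by
          rw [← Real.exp_nat_mul]
          push_cast [Nat.cast_sub hUn]
          ring_nf
      _ ≤ _ := by
          rw [Real.exp_le_exp, neg_le_neg_iff]
          have h1 : (δ * n) * (δ * n) ≤ U.card * (n - U.card : ℝ) :=
            mul_le_mul hU1 (by linarith) (by positivity) (Nat.cast_nonneg _)
          rw [div_le_iff₀ (by positivity)] at hc
          calc 2 * (n : ℝ) ≤ (n * p * δ ^ 2) * n := by gcongr
            _ = (δ * n) * (δ * n) * p := by ring
            _ ≤ _ := by gcongr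
  rw [hset]
  calc _ ≤ ∑ U ∈ 𝓤, _ := measureReal_biUnion_finset_le _ _
    _ ≤ 𝓤.card • Real.exp (-(2 * n)) := Finset.sum_le_card_nsmul _ _ _ hterm
    _ ≤ 2 ^ n * Real.exp (-(2 * n)) := by
        rw [nsmul_eq_mul]
        gcongr
        have : 𝓤.card ≤ 2 ^ n := by
          rw [← hB, ← Finset.card_powerset]
          exact Finset.card_filter_le _ _
        exact_mod_cast this
    _ ≤ Real.exp 1 ^ n * Real.exp (-(2 * n)) := by
        gcongr
        exact Real.add_one_le_exp 1 |>.trans' (by norm_num)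
    _ = Real.exp (-n) := by
        rw [← Real.exp_nat_mul, ← Real.exp_add]
        ring_nf

end TemporalSBM

/-! ### Error bounds for a single model -/

namespace TemporalSBM

variable {M : TemporalSBM}

theorem sum_blockSize (M : TemporalSBM) : ∑ k, M.blockSize k = M.N := by
  have := Finset.card_eq_sum_card_fiberwise (f := M.σ) (s := Finset.univ) (t := Finset.univ)
    fun _ _ => Finset.mem_coe.2 (Finset.mem_univ _)
  rw [Finset.card_univ, Fintype.card_fin] at this
  exact this.symm

theorem mean_degree_le_blockSize (k : Fin M.K) :
    (M.blockSize k : ℝ) * M.persistProb k k ≤ M.blockSize k :=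
  mul_le_of_le_one_right (Nat.cast_nonneg _) (M.persistProb_le_one k k)

theorem law_not_exact_recovery_le {m : ℝ} {τ : M.Obs → Fin M.N → ℕ}
    (hτ : ∀ x, IsComponentLabelling (M.persistentGraph x) m (τ x))
    (hne : ∀ k, 0 < M.blockSize k) (hm : ∀ k, m ≤ M.blockSize k) :
    M.law.real {x | classificationError M.trueLabel (τ x) = 0 ∧
      estimatedBlockCount (M.persistentGraph x) m = M.K}ᶜ ≤
    M.law.real {x | ¬ NoInterBlockEdge (M.persistentGraph x) M.σ} +
      ∑ k, M.law.real {x | ∃ S ∈ M.minoritySets k 1,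
        IsCluster (M.persistentGraph x) (block M.σ k) S} := by
  have hsub : {x | classificationError M.trueLabel (τ x) = 0 ∧
      estimatedBlockCount (M.persistentGraph x) m = M.K}ᶜ ⊆
      {x | ¬ NoInterBlockEdge (M.persistentGraph x) M.σ} ∪
        ⋃ k, {x | ∃ S ∈ M.minoritySets k 1,
          IsCluster (M.persistentGraph x) (block M.σ k) S} := by
    intro x hx
    by_contra hgood
    simp only [Set.mem_union, Set.mem_iUnion, Set.mem_ofPred_eq, not_or, not_not, not_exists,
      not_and, mem_minoritySets] at hgood
    refine hx (hgood.1.exact_recovery (hτ x) (fun k => Finset.card_pos.1 (hne k)) hm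
      fun k S hS hcl => ?_)
    by_contra! hle
    have hpos : 0 < S.card := by
      obtain ⟨v⟩ := hcl.1.nonempty
      exact Finset.card_pos.2 ⟨v, v.2⟩
    exact hgood.2 k S ⟨hS, hpos, hle⟩ hcl
  exact (measureReal_mono hsub (measure_ne_top _ _)).trans ((measureReal_union_le _ _).trans
    (add_le_add le_rfl (measureReal_iUnion_fintype_le _)))

theorem law_estimatedBlockCount_ne_le {m δ : ℝ} {a : ℕ} (hδ : δ ≤ 1 / 3)
    (hne : ∀ k, 0 < M.blockSize k) (ham : ∀ s : ℕ, m ≤ s → a ≤ s)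
    (hm : ∀ k, m ≤ (1 - δ) * M.blockSize k) :
    M.law.real {x | estimatedBlockCount (M.persistentGraph x) m = M.K}ᶜ ≤
    M.law.real {x | ¬ NoInterBlockEdge (M.persistentGraph x) M.σ} +
      ∑ k, (M.law.real {x | ∃ S ∈ M.minoritySets k a,
          IsCluster (M.persistentGraph x) (block M.σ k) S} +
        M.law.real {x | ∃ U ⊆ block M.σ k, δ * (block M.σ k).card ≤ U.card ∧
          (U.card : ℝ) ≤ (1 - δ) * (block M.σ k).card ∧
          IsSeparated (M.persistentGraph x) (block M.σ k) U}) := by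
  have hsub : {x | estimatedBlockCount (M.persistentGraph x) m = M.K}ᶜ ⊆
      {x | ¬ NoInterBlockEdge (M.persistentGraph x) M.σ} ∪
        ⋃ k, ({x | ∃ S ∈ M.minoritySets k a,
            IsCluster (M.persistentGraph x) (block M.σ k) S} ∪
          {x | ∃ U ⊆ block M.σ k, δ * (block M.σ k).card ≤ U.card ∧
            (U.card : ℝ) ≤ (1 - δ) * (block M.σ k).card ∧
            IsSeparated (M.persistentGraph x) (block M.σ k) U}) := by
    intro x hx
    by_contra hgood
    simp only [Set.mem_union, Set.mem_iUnion, Set.mem_ofPred_eq, not_or, not_not, not_exists,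
      not_and, mem_minoritySets] at hgood
    obtain ⟨hinter, hk⟩ := hgood
    have hmaj : ∀ i, InLargeComponent (M.persistentGraph x) m i →
        (block M.σ (M.σ i)).card < 2 * (nodeComponent (M.persistentGraph x) i).card := by
      intro i hi
      by_contra! hle
      exact (hk (M.σ i)).1 _ ⟨hinter.nodeComponent_subset i,
        ham _ (inLargeComponent_iff.1 hi), hle⟩ (isCluster_nodeComponent _ i)
    refine hx (hinter.estimatedBlockCount_eq (fun k => ?_) fun i j hi hj hij =>
      hinter.reachable_of_majority hij (hmaj i hi) (hmaj j hj))
    obtain ⟨i, hi, hcard⟩ := hinter.exists_giant hδ (Finset.card_pos.1 (hne k)) (hk k).2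
    exact ⟨i, hi, inLargeComponent_iff.2 ((hm k).trans hcard)⟩
  refine (measureReal_mono hsub (measure_ne_top _ _)).trans ((measureReal_union_le _ _).trans
    (add_le_add le_rfl ((measureReal_iUnion_fintype_le _).trans
      (Finset.sum_le_sum fun k _ => measureReal_union_le _ _))))

/-- The nodes of blocks with fewer than `2 m` nodes are few. -/
theorem card_small_blocks_le (m : ℝ) :
    (((Finset.univ : Finset (Fin M.N)).filter fun i =>
      ((block M.σ (M.σ i)).card : ℝ) < 2 * m).card : ℝ) ≤ M.K * max 0 (2 * m) := by
  classical
  rw [Finset.card_eq_sum_card_fiberwise (f := M.σ) (t := Finset.univ)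
    fun _ _ => Finset.mem_coe.2 (Finset.mem_univ _)]
  push_cast
  have : ∀ k ∈ (Finset.univ : Finset (Fin M.K)),
      ((((Finset.univ : Finset (Fin M.N)).filter fun i =>
        ((block M.σ (M.σ i)).card : ℝ) < 2 * m).filter fun i => M.σ i = k).card : ℝ) ≤
        max 0 (2 * m) := by
    intro k _
    by_cases hk : ((block M.σ k).card : ℝ) < 2 * m
    · refine le_trans ?_ (hk.le.trans (le_max_right _ _))
      refine Nat.cast_le.2 (Finset.card_le_card fun i hi => ?_)
      exact mem_block.2 (Finset.mem_filter.1 hi).2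
    · rw [Finset.filter_eq_empty_iff.2]
      · simp
      · intro i hi hik
        rw [Finset.mem_filter, hik] at hi
        exact hk hi.2
  refine (Finset.sum_le_card_nsmul _ _ _ this).trans (le_of_eq ?_)
  rw [nsmul_eq_mul, Finset.card_univ, Fintype.card_fin]

theorem integral_classificationError_le {m : ℝ} {τ : M.Obs → Fin M.N → ℕ}
    (hτ : ∀ x, IsComponentLabelling (M.persistentGraph x) m (τ x)) :
    ∫ x, (classificationError M.trueLabel (τ x) : ℝ) ∂M.law ≤
      M.N * M.law.real {x | ¬ NoInterBlockEdge (M.persistentGraph x) M.σ} +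
      M.K * max 0 (2 * m) +
      ∑ k, ∑ S ∈ M.minoritySets k 1, (S.card : ℝ) *
        M.law.real {x | IsCluster (M.persistentGraph x) (block M.σ k) S} := by
  classical
  let E : Set M.Obs := {x | ¬ NoInterBlockEdge (M.persistentGraph x) M.σ}
  let C : Fin M.K → Finset (Fin M.N) → Set M.Obs := fun k S =>
    {x | IsCluster (M.persistentGraph x) (block M.σ k) S}
  let Z : Finset (Fin M.N) := Finset.univ.filter fun i =>
    ((block M.σ (M.σ i)).card : ℝ) < 2 * m
  have hpoint : ∀ x, (classificationError M.trueLabel (τ x) : ℝ) ≤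
      M.N * E.indicator 1 x + M.K * max 0 (2 * m) +
        ∑ k, ∑ S ∈ M.minoritySets k 1, (S.card : ℝ) * (C k S).indicator 1 x := by
    intro x
    have hsum0 : ∀ k, 0 ≤ ∑ S ∈ M.minoritySets k 1, (S.card : ℝ) * (C k S).indicator 1 x :=
      fun k => Finset.sum_nonneg fun S _ =>
        mul_nonneg (Nat.cast_nonneg _) (Set.indicator_nonneg (fun _ _ => zero_le_one) _)
    by_cases hx : x ∈ E
    · rw [Set.indicator_of_mem hx, Pi.one_apply, mul_one, add_assoc]
      have h1 : (classificationError M.trueLabel (τ x) : ℝ) ≤ M.N := by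
        exact_mod_cast classificationError_le_card _ _
      have h2 : (0 : ℝ) ≤ M.K * max 0 (2 * m) := by positivity
      have h3 := Finset.sum_nonneg fun k (_ : k ∈ Finset.univ) => hsum0 k
      linarith
    · rw [Set.indicator_of_notMem hx, mul_zero, zero_add]
      have hinter : NoInterBlockEdge (M.persistentGraph x) M.σ := not_not.1 hx
      let 𝓒 : Fin M.K → Finset (Finset (Fin M.N)) := fun k =>
        (M.minoritySets k 1).filter fun S => x ∈ C k S
      let Y : Finset (Fin M.N) := Finset.univ.biUnion fun k => (𝓒 k).biUnion id
      have hY : (Y.card : ℝ) ≤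
          ∑ k, ∑ S ∈ M.minoritySets k 1, (S.card : ℝ) * (C k S).indicator 1 x := by
        have h1 : Y.card ≤ ∑ k, ∑ S ∈ 𝓒 k, S.card :=
          Finset.card_biUnion_le.trans (Finset.sum_le_sum fun k _ => Finset.card_biUnion_le)
        refine (Nat.cast_le.2 h1).trans (le_of_eq ?_)
        push_cast
        refine Finset.sum_congr rfl fun k _ => ?_
        rw [Finset.sum_filter]
        refine Finset.sum_congr rfl fun S _ => ?_
        by_cases hS : x ∈ C k S <;> simp [hS]
      have herr := hinter.classificationError_le (hτ x) Z Y
        (fun i hi => by simpa [Z] using hi) fun i hi S hS hiS hcl => by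
          by_contra! hle
          refine hi (Finset.mem_biUnion.2 ⟨M.σ i, Finset.mem_univ _, Finset.mem_biUnion.2
            ⟨S, Finset.mem_filter.2 ⟨mem_minoritySets.2
              ⟨hS, Finset.card_pos.2 ⟨i, hiS⟩, hle⟩, hcl⟩, hiS⟩⟩)
      have hZ : (Z.card : ℝ) ≤ M.K * max 0 (2 * m) := card_small_blocks_le m
      calc (classificationError M.trueLabel (τ x) : ℝ) ≤ Z.card + Y.card := by
            exact_mod_cast herr
        _ ≤ _ := add_le_add hZ hY
  have hmeas : ∀ s : Set M.Obs, MeasurableSet s := fun s => (Set.toFinite s).measurableSet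
  have hind : ∀ s : Set M.Obs, ∫ x, s.indicator (1 : M.Obs → ℝ) x ∂M.law = M.law.real s :=
    fun s => integral_indicator_one (hmeas s)
  refine (integral_mono Integrable.of_finite Integrable.of_finite hpoint).trans (le_of_eq ?_)
  rw [integral_add Integrable.of_finite Integrable.of_finite,
    integral_add Integrable.of_finite Integrable.of_finite, integral_const_mul, hind,
    integral_const, probReal_univ, one_smul,
    integral_finsetSum _ fun _ _ => Integrable.of_finite]
  congr 1
  refine Finset.sum_congr rfl fun k _ => ?_
  rw [integral_finsetSum _ fun _ _ => Integrable.of_finite]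
  refine Finset.sum_congr rfl fun S _ => ?_
  rw [integral_const_mul, hind]

end TemporalSBM

/-! ### Limits along a sequence of models -/

theorem tendsto_law_one {M : ℕ → TemporalSBM} {E : ∀ n, Set (M n).Obs}
    (h : ∀ ε : ℝ, 0 < ε → ∀ᶠ n in atTop, (M n).law.real (E n)ᶜ ≤ ε) :
    Tendsto (fun n => (M n).law (E n)) atTop (𝓝 1) := by
  rw [← ENNReal.tendsto_toReal_iff (fun n => measure_ne_top _ _) ENNReal.one_ne_top,
    ENNReal.toReal_one, Metric.tendsto_nhds]
  intro ε hε
  filter_upwards [h (ε / 2) (half_pos hε)] with n hn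
  rw [probReal_compl_eq_one_sub (Set.toFinite _).measurableSet, measureReal_def] at hn
  have h1 : ((M n).law (E n)).toReal ≤ 1 := ENNReal.toReal_le_of_le_ofReal zero_le_one
    (by simpa using prob_le_one)
  rw [Real.dist_eq, abs_sub_lt_iff]
  constructor <;> linarith

section Limits

variable {M : ℕ → TemporalSBM} {m : ℕ → ℝ} {τ : ∀ n, (M n).Obs → Fin (M n).N → ℕ}

theorem eventually_law_not_noInterBlockEdge_le
    (hinter : ∀ ε : ℝ, 0 < ε → ∀ᶠ n in atTop, ∀ k l : Fin (M n).K, k ≠ l →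
      ((M n).N : ℝ) ^ 2 * (M n).persistProb k l ≤ ε) {ε : ℝ} (hε : 0 < ε) :
    ∀ᶠ n in atTop,
      (M n).law.real {x | ¬ NoInterBlockEdge ((M n).persistentGraph x) (M n).σ} ≤ ε := by
  filter_upwards [hinter ε hε] with n hn
  exact (M n).law_not_noInterBlockEdge_le hε.le hn

theorem tendsto_law_exact_recovery
    (hinter : ∀ ε : ℝ, 0 < ε → ∀ᶠ n in atTop, ∀ k l : Fin (M n).K, k ≠ l →
      ((M n).N : ℝ) ^ 2 * (M n).persistProb k l ≤ ε)
    (hτ : ∀ n x, IsComponentLabelling ((M n).persistentGraph x) (m n) (τ n x))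
    (hm : ∀ᶠ n in atTop, ∀ k, m n ≤ ((M n).blockSize k : ℝ))
    (hconn : ∀ C : ℝ, ∀ᶠ n in atTop, ∀ k,
      C ≤ ((M n).blockSize k : ℝ) * (M n).persistProb k k -
        Real.log (((M n).K : ℝ) * (M n).blockSize k)) :
    Tendsto (fun n => (M n).law {x |
        classificationError (M n).trueLabel (τ n x) = 0 ∧
        estimatedBlockCount ((M n).persistentGraph x) (m n) = (M n).K})
      atTop (𝓝 1) := by
  refine tendsto_law_one fun ε hε => ?_
  have htail : ∀ᶠ ω : ℝ in atTop, 2 * (Real.exp 3 * Real.exp (-ω)) ≤ ε / 2 := by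
    have := (Real.tendsto_exp_neg_atTop_nhds_zero.const_mul (Real.exp 3)).const_mul 2
    rw [mul_zero, mul_zero] at this
    exact this.eventually_le_const (half_pos hε)
  obtain ⟨c₀, hc₀⟩ := eventually_atTop.1
    (eventually_clusterRatio_le (by norm_num : (0 : ℝ) < 1 / 2))
  obtain ⟨ω, ⟨hω, hωc⟩, hω6⟩ :=
    ((htail.and (eventually_ge_atTop c₀)).and (eventually_ge_atTop 6)).exists
  filter_upwards [hm, hconn ω, eventually_law_not_noInterBlockEdge_le hinter (half_pos hε)]
    with n hm hconn hinter
  have hlog : ∀ k, 0 ≤ Real.log (((M n).K : ℝ) * (M n).blockSize k) := fun k => by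
    rw [← Nat.cast_mul]
    exact Real.log_natCast_nonneg _
  have hc : ∀ k, ω ≤ (M n).blockSize k * (M n).persistProb k k := fun k => by
    linarith [hconn k, hlog k]
  have hsize : ∀ k, 6 ≤ (M n).blockSize k := fun k => by
    have := (hω6.trans (hc k)).trans (TemporalSBM.mean_degree_le_blockSize k)
    exact_mod_cast this
  refine (TemporalSBM.law_not_exact_recovery_le (hτ n)
    (fun k => lt_of_lt_of_le (by norm_num) (hsize k)) hm).trans ?_
  have hblock : ∀ k ∈ (Finset.univ : Finset (Fin (M n).K)),
      (M n).law.real {x | ∃ S ∈ (M n).minoritySets k 1,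
        IsCluster ((M n).persistentGraph x) (block (M n).σ k) S} ≤
      2 * (Real.exp 3 * Real.exp (-ω)) / (M n).K := by
    intro k _
    refine (TemporalSBM.law_exists_minority_cluster_le le_rfl).trans
      ((TemporalSBM.sum_minoritySets_le_exp (hsize k) (hc₀ _ (hωc.trans (hc k)))).trans ?_)
    have hK : (0 : ℝ) < (M n).K := by exact_mod_cast k.pos
    have hn : (0 : ℝ) < (M n).blockSize k := by
      exact_mod_cast lt_of_lt_of_le (by norm_num) (hsize k)
    -- `N_k exp (-N_k p_kk) ≤ N_k exp (-ω) / (K N_k)`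
    have hexp : Real.exp (-((M n).blockSize k * (M n).persistProb k k)) ≤
        Real.exp (-ω) / ((M n).K * (M n).blockSize k) := by
      rw [← Real.exp_log (mul_pos hK hn), ← Real.exp_sub, Real.exp_le_exp]
      linarith [hconn k]
    calc _ ≤ 2 * (Real.exp 3 * ((M n).blockSize k *
          (Real.exp (-ω) / ((M n).K * (M n).blockSize k)))) := by gcongr
      _ = _ := by field_simp
  have hsum := Finset.sum_le_card_nsmul _ _ _ hblock
  rw [nsmul_eq_mul, Finset.card_univ, Fintype.card_fin] at hsum
  have hcancel : ((M n).K : ℝ) * (2 * (Real.exp 3 * Real.exp (-ω)) / (M n).K) ≤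
      2 * (Real.exp 3 * Real.exp (-ω)) := by
    rw [mul_div_left_comm]
    exact mul_le_of_le_one_right (by positivity) (div_self_le_one _)
  linarith

theorem tendsto_integral_classificationError_div
    (hN : Tendsto (fun n => (M n).N) atTop atTop)
    (hinter : ∀ ε : ℝ, 0 < ε → ∀ᶠ n in atTop, ∀ k l : Fin (M n).K, k ≠ l →
      ((M n).N : ℝ) ^ 2 * (M n).persistProb k l ≤ ε)
    (hτ : ∀ n x, IsComponentLabelling ((M n).persistentGraph x) (m n) (τ n x))
    (hm : ∀ ε : ℝ, 0 < ε → ∀ᶠ n in atTop, ((M n).K : ℝ) * m n ≤ ε * (M n).N)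
    (hdeg : ∀ C : ℝ, ∀ᶠ n in atTop, ∀ k,
      C ≤ ((M n).blockSize k : ℝ) * (M n).persistProb k k) :
    Tendsto (fun n =>
        (∫ x, (classificationError (M n).trueLabel (τ n x) : ℝ) ∂(M n).law) / (M n).N)
      atTop (𝓝 0) := by
  rw [Metric.tendsto_nhds]
  intro ε hε
  obtain ⟨η, hη, hηε, hη2⟩ : ∃ η : ℝ, 0 < η ∧ 5 * η < ε ∧ η ≤ 1 / 2 :=
    ⟨min (ε / 6) (1 / 2), by positivity, by
      have := min_le_left (ε / 6) (1 / 2)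
      linarith, min_le_right _ _⟩
  obtain ⟨c₀, hc₀⟩ := eventually_atTop.1 (eventually_clusterRatio_le hη)
  filter_upwards [hN.eventually_gt_atTop 0, hm η hη, hdeg (max c₀ 1),
    eventually_law_not_noInterBlockEdge_le hinter hη] with n hN hm hdeg hinter
  have hN' : (0 : ℝ) < (M n).N := by exact_mod_cast hN
  have hsmall : ((M n).K : ℝ) * max 0 (2 * m n) ≤ 2 * (η * (M n).N) := by
    rw [mul_max_of_nonneg _ _ (Nat.cast_nonneg _), mul_zero]
    exact max_le (by positivity) (by linarith)
  have hclusters : ∑ k, ∑ S ∈ (M n).minoritySets k 1, (S.card : ℝ) *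
      (M n).law.real {x | IsCluster ((M n).persistentGraph x) (block (M n).σ k) S} ≤
      2 * (η * (M n).N) := by
    calc _ ≤ ∑ k, 2 * ((M n).blockSize k * η ^ 1) := Finset.sum_le_sum fun k _ =>
          TemporalSBM.sum_minoritySets_le_pow le_rfl ((le_max_right _ _).trans (hdeg k))
            (hc₀ _ ((le_max_left _ _).trans (hdeg k))) hη2
      _ = 2 * ((∑ k, (M n).blockSize k : ℕ) * η ^ 1) := by
          rw [← Finset.mul_sum, ← Finset.sum_mul, Nat.cast_sum]
      _ = _ := by rw [(M n).sum_blockSize]; ring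
  have htotal := TemporalSBM.integral_classificationError_le (hτ n)
  have hfirst := mul_le_mul_of_nonneg_left hinter hN'.le
  have hnonneg : 0 ≤ ∫ x, (classificationError (M n).trueLabel (τ n x) : ℝ) ∂(M n).law :=
    integral_nonneg fun _ => Nat.cast_nonneg _
  rw [Real.dist_0_eq_abs, abs_of_nonneg (by positivity), div_lt_iff₀ hN']
  have := mul_lt_mul_of_pos_right hηε hN'
  linarith

theorem tendsto_law_estimatedBlockCount
    (hN : Tendsto (fun n => (M n).N) atTop atTop)
    (hinter : ∀ ε : ℝ, 0 < ε → ∀ᶠ n in atTop, ∀ k l : Fin (M n).K, k ≠ l →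
      ((M n).N : ℝ) ^ 2 * (M n).persistProb k l ≤ ε)
    (hm : ∃ δ : ℝ, 0 < δ ∧ ∀ᶠ n in atTop, Real.sqrt (M n).N ≤ m n ∧
      ∀ k, m n ≤ (1 - δ) * (M n).blockSize k)
    (hdeg : ∀ C : ℝ, ∀ᶠ n in atTop, ∀ k,
      C ≤ ((M n).blockSize k : ℝ) * (M n).persistProb k k) :
    Tendsto (fun n => (M n).law {x |
        estimatedBlockCount ((M n).persistentGraph x) (m n) = (M n).K})
      atTop (𝓝 1) := by
  obtain ⟨δ', hδ', hm⟩ := hm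
  obtain ⟨δ, hδ, hδδ', hδ3⟩ : ∃ δ : ℝ, 0 < δ ∧ δ ≤ δ' ∧ δ ≤ 1 / 3 :=
    ⟨min δ' (1 / 3), by positivity, min_le_left _ _, min_le_right _ _⟩
  refine tendsto_law_one fun ε hε => ?_
  obtain ⟨c₀, hc₀⟩ := eventually_atTop.1 (eventually_clusterRatio_le (Real.exp_pos (-1)))
  have hexp : Real.exp (-1) ≤ 1 / 2 := by
    rw [Real.exp_neg, inv_le_comm₀ (Real.exp_pos _) (by norm_num)]
    exact Real.add_one_le_exp 1 |>.trans' (by norm_num)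
  have htail : ∀ᶠ n in atTop,
      3 * ((M n).N * Real.exp (-Real.sqrt (M n).N)) ≤ ε / 2 := by
    have h1 : Tendsto (fun n => Real.sqrt (M n).N) atTop atTop :=
      Real.tendsto_sqrt_atTop.comp (tendsto_natCast_atTop_atTop.comp hN)
    have h2 := ((Real.tendsto_pow_mul_exp_neg_atTop_nhds_zero 2).comp h1).const_mul 3
    rw [mul_zero] at h2
    filter_upwards [h2.eventually_le_const (half_pos hε)] with n hn
    simpa [Function.comp, Real.sq_sqrt (Nat.cast_nonneg (α := ℝ) _)] using hn
  filter_upwards [hN.eventually_gt_atTop 0, hm, hdeg (max c₀ (max 1 (2 / δ ^ 2))), htail,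
    eventually_law_not_noInterBlockEdge_le hinter (half_pos hε)] with n hN hm hdeg htail hinter
  have hc0 : ∀ k, c₀ ≤ (M n).blockSize k * (M n).persistProb k k := fun k =>
    (le_max_left _ _).trans (hdeg k)
  have hc1 : ∀ k, 1 ≤ (M n).blockSize k * (M n).persistProb k k := fun k =>
    (le_max_left _ _).trans ((le_max_right _ _).trans (hdeg k))
  have hc2 : ∀ k, 2 / δ ^ 2 ≤ (M n).blockSize k * (M n).persistProb k k := fun k =>
    (le_max_right _ _).trans ((le_max_right _ _).trans (hdeg k))
  have hone : ∀ k, (1 : ℝ) ≤ (M n).blockSize k := fun k =>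
    (hc1 k).trans (TemporalSBM.mean_degree_le_blockSize k)
  have hmδ : ∀ k, m n ≤ (1 - δ) * (M n).blockSize k := fun k =>
    (hm.2 k).trans (mul_le_mul_of_nonneg_right (by linarith) (Nat.cast_nonneg _))
  have hsqrt : ∀ k, Real.sqrt (M n).N ≤ (M n).blockSize k := fun k => by
    have := mul_nonneg hδ.le (zero_le_one.trans (hone k))
    linarith [hm.1, hmδ k]
  have ha : 1 ≤ ⌈Real.sqrt (M n).N⌉₊ := Nat.ceil_pos.2 (Real.sqrt_pos.2 (by exact_mod_cast hN))
  refine (TemporalSBM.law_estimatedBlockCount_ne_le (a := ⌈Real.sqrt (M n).N⌉₊) hδ3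
    (fun k => by exact_mod_cast hone k) (fun s hs => Nat.ceil_le.2 (hm.1.trans hs)) hmδ).trans ?_
  have hblock : ∀ k ∈ (Finset.univ : Finset (Fin (M n).K)),
      (M n).law.real {x | ∃ S ∈ (M n).minoritySets k ⌈Real.sqrt (M n).N⌉₊,
        IsCluster ((M n).persistentGraph x) (block (M n).σ k) S} +
      (M n).law.real {x | ∃ U ⊆ block (M n).σ k, δ * (block (M n).σ k).card ≤ U.card ∧
        (U.card : ℝ) ≤ (1 - δ) * (block (M n).σ k).card ∧
        IsSeparated ((M n).persistentGraph x) (block (M n).σ k) U} ≤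
      (M n).blockSize k * (3 * Real.exp (-Real.sqrt (M n).N)) := by
    intro k _
    have h1 := (TemporalSBM.law_exists_minority_cluster_le (k := k) ha).trans
      (TemporalSBM.sum_minoritySets_le_pow ha (hc1 k) (hc₀ _ (hc0 k)) hexp)
    have h2 := TemporalSBM.law_exists_balanced_cut_le hδ (hc2 k)
    have h3 : Real.exp (-1) ^ ⌈Real.sqrt (M n).N⌉₊ ≤ Real.exp (-Real.sqrt (M n).N) := by
      rw [← Real.exp_nat_mul, Real.exp_le_exp]
      linarith [Nat.le_ceil (Real.sqrt (M n).N)]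
    have h4 : Real.exp (-((M n).blockSize k : ℝ)) ≤
        (M n).blockSize k * Real.exp (-Real.sqrt (M n).N) :=
      (Real.exp_le_exp.2 (neg_le_neg (hsqrt k))).trans
        (le_mul_of_one_le_left (Real.exp_pos _).le (hone k))
    have h5 := mul_le_mul_of_nonneg_left h3 (zero_le_one.trans (hone k))
    linarith
  have hsum := Finset.sum_le_sum hblock
  rw [← Finset.sum_mul, ← Nat.cast_sum, (M n).sum_blockSize] at hsum
  linarith

/-- Exact recovery under a multiplicative margin: there the additive margin is at least
`ε log (K N_k)`. -/
theorem eventually_le_sub_log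
    (hsize : ∀ C : ℝ, ∀ᶠ n in atTop, ∀ k, C ≤ ((M n).K : ℝ) * (M n).blockSize k)
    (hratio : ∃ ε : ℝ, 0 < ε ∧ ∀ᶠ n in atTop, ∀ k,
      1 + ε ≤ ((M n).blockSize k : ℝ) * (M n).persistProb k k /
        Real.log (((M n).K : ℝ) * (M n).blockSize k)) (C : ℝ) :
    ∀ᶠ n in atTop, ∀ k, C ≤ ((M n).blockSize k : ℝ) * (M n).persistProb k k -
      Real.log (((M n).K : ℝ) * (M n).blockSize k) := by
  obtain ⟨ε, hε, hratio⟩ := hratio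
  filter_upwards [hratio, hsize (Real.exp (max 1 (C / ε)))] with n hratio hsize k
  have hlog : max 1 (C / ε) ≤ Real.log (((M n).K : ℝ) * (M n).blockSize k) := by
    rw [Real.le_log_iff_exp_le ((Real.exp_pos _).trans_le (hsize k))]
    exact hsize k
  have hpos := zero_lt_one.trans_le ((le_max_left _ _).trans hlog)
  have h1 := (le_div_iff₀ hpos).1 (hratio k)
  have h2 := (div_le_iff₀ hε).1 ((le_max_right _ _).trans hlog)
  linarith

end Limits

theorem mainTheorem10
    (M : ℕ → TemporalSBM)
    (hN : Tendsto (fun n => (M n).N) atTop atTop)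
    (hinter : ∀ ε : ℝ, 0 < ε → ∀ᶠ n in atTop, ∀ k l : Fin (M n).K, k ≠ l →
      ((M n).N : ℝ) ^ 2 * (M n).persistProb k l ≤ ε)
    (m : ℕ → ℝ)
    (τ : ∀ n, (M n).Obs → Fin (M n).N → ℕ)
    (hτ : ∀ n x, IsComponentLabelling ((M n).persistentGraph x) (m n) (τ n x)) :
    -- exact recovery
    ((∀ᶠ n in atTop, ∀ k, m n ≤ ((M n).blockSize k : ℝ)) →
      (∀ C : ℝ, ∀ᶠ n in atTop, ∀ k, C ≤ ((M n).K : ℝ) * (M n).blockSize k) →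
      (∃ ε : ℝ, 0 < ε ∧ ∀ᶠ n in atTop, ∀ k,
        1 + ε ≤ ((M n).blockSize k : ℝ) * (M n).persistProb k k /
          Real.log (((M n).K : ℝ) * (M n).blockSize k)) →
      Tendsto (fun n => (M n).law {x |
          classificationError (M n).trueLabel (τ n x) = 0 ∧
          estimatedBlockCount ((M n).persistentGraph x) (m n) = (M n).K})
        atTop (𝓝 1)) ∧
    -- exact recovery, up to the connectivity threshold
    ((∀ᶠ n in atTop, ∀ k, m n ≤ ((M n).blockSize k : ℝ)) →
      (∀ C : ℝ, ∀ᶠ n in atTop, ∀ k, C ≤ ((M n).blockSize k : ℝ) * (M n).persistProb k k -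
        Real.log (((M n).K : ℝ) * (M n).blockSize k)) →
      Tendsto (fun n => (M n).law {x |
          classificationError (M n).trueLabel (τ n x) = 0 ∧
          estimatedBlockCount ((M n).persistentGraph x) (m n) = (M n).K})
        atTop (𝓝 1)) ∧
    -- consistency
    ((∀ ε : ℝ, 0 < ε → ∀ᶠ n in atTop, ((M n).K : ℝ) * m n ≤ ε * (M n).N) →
      (∀ C : ℝ, ∀ᶠ n in atTop, ∀ k, C ≤ ((M n).blockSize k : ℝ) * (M n).persistProb k k) →
      Tendsto (fun n =>
          (∫ x, (classificationError (M n).trueLabel (τ n x) : ℝ) ∂(M n).law) / (M n).N)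
        atTop (𝓝 0)) ∧
    -- correct estimation of the number of blocks
    ((∃ δ : ℝ, 0 < δ ∧ ∀ᶠ n in atTop, Real.sqrt (M n).N ≤ m n ∧
        ∀ k, m n ≤ (1 - δ) * (M n).blockSize k) →
      (∀ C : ℝ, ∀ᶠ n in atTop, ∀ k, C ≤ ((M n).blockSize k : ℝ) * (M n).persistProb k k) →
      Tendsto (fun n => (M n).law {x |
          estimatedBlockCount ((M n).persistentGraph x) (m n) = (M n).K})
        atTop (𝓝 1)) := by
  exact ⟨fun hm hsize hratio => tendsto_law_exact_recovery hinter hτ hm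
      (eventually_le_sub_log hsize hratio),
    tendsto_law_exact_recovery hinter hτ,
    tendsto_integral_classificationError_div hN hinter hτ,
    tendsto_law_estimatedBlockCount hN hinter⟩
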